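/- \textbf{Model.} A \emph{symmetric tree topology} is a finite tree with vertex set $V$ in which every edge $\{u,v\}$ consists of two directed links $(u,v)$, $(v,u)$ with the same bandwidth $w_e=w_{(u,v)}=w_{(v,u)}\in[0,\infty]$, together with a set $V_C\subseteq V$ of compute nodes; the other nodes only route. The elements of two finite sets $R,S$ with $|R|=|S|=N/2$ are initially partitioned among the compute nodes, node $v$ holding $R_v\subseteq R$ and $S_v\subseteq S$; put $N_v=|R_v|+|S_v|$. In each round of an algorithm every compute node sends, to every compute node, a set of elements chosen among those that it currently stores, along the path of the tree, and receiving nodes store what they receive; an element sent to several nodes counts once on each link. The (tuple) cost of a round is $\max_e |Y(e)|/w_e$ over all directed links $e$, where $Y(e)$ is the set of elements routed through $e$ (with $x/0=\infty$ for $x>0$, $0/0=0$, $x/\infty=0$), and the cost of an algorithm is the sum over its rounds. An algorithm computes $R\times S$ if at the end, for every pair $(a,b)\in R\times S$, some compute node stores both $a$ and $b$. \textbf{Lower bounds.} For a link $e=(u,v)$ let $V_e^-$ and $V_e^+$ be the sets of vertices on the side of $u$ and of $v$ when the edge is removed, and for $X\subseteq V$ let $N(X)=\sum_{x\in X\cap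 V_C}N_x$. Call a vertex $r$ a \emph{root} if $N(V_e^-)\le N(V_e^+)$ for every link $e$ directed towards $r$, and let $G^\dagger_r$ be the tree with all edges directed towards $r$. For $x\ne r$ let $w_x$ be the bandwidth of the link leaving $x$ in $G_r^\dagger$. A \emph{cover} is a set $U\subseteq V$ such that every compute node has an ancestor in $U$ in $G_r^\dagger$ (a node being an ancestor of itself). Put \[ L_1=\max_{e}\frac{\min\{N(V_e^-),N(V_e^+)\}}{w_e},\qquad L_2(r)=\max_{U}\frac{N}{\sqrt{\sum_{x\in U}w_x^2}}, \] where $e$ ranges over all links and $U$ over all inclusion-minimal covers of $G_r^\dagger$ with $U\neq\{r\}$ (a maximum over the empty set is $0$). \textbf{Theorem.} There is an absolute constant $C$ such that the following holds. For every symmetric tree topology and every choice of the sizes $|R_v|,|S_v|$ ($v\in V_C$) with $|R|=|S|=N/2$ there is a deterministic one-round algorithm $A$, in which the messages of each node depend only on the topology, the bandwidths, these sizes and the node's own data, such that on every input with these sizes: \begin{enumerate} \item $A$ computes $R\times S$; \item $\mathrm{cost}(A)\le C\cdot\mathrm{cost}(B)$ for every algorithm $B$, with any number of rounds, that computes $R\times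 S$ on that input; \item for every root $r$, every algorithm $B$ that computes $R\times S$ on that input has $\max\{L_1,L_2(r)\}\le C\cdot\mathrm{cost}(B)$, and $A$ matches these bounds up to the time needed to send one element through the slowest link: \[\mathrm{cost}(A)\le C\cdot\max\Bigl\{L_1,\;L_2(r),\;\max_e\tfrac1{w_e}\Bigr\}.\] \end{enumerate} -/

import Mathlib

open scoped ENNReal NNReal

universe u v

namespace TopoMPC

/-- A symmetric tree topology: a tree each of whose edges is a pair of opposite directed links
(the darts of `graph`) of equal bandwidth, with a distinguished set of compute nodes; the other
nodes only route. Bandwidths lie in `[0, ∞]`. -/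
structure SymmetricTree (V : Type u) where
  graph : SimpleGraph V
  isTree : graph.IsTree
  bandwidth : graph.Dart → ℝ≥0∞
  bandwidth_symm : ∀ e, bandwidth e.symm = bandwidth e
  compute : Finset V

namespace SymmetricTree

variable {V : Type u} (G : SymmetricTree V)

/-- The compute nodes. -/
abbrev Node : Type u := {x : V // x ∈ G.compute}

/-- The directed link `e` lies on the path of the tree that leads from `x` to `y`. -/
def OnRoute (x y : V) (e : G.graph.Dart) : Prop :=
  ∃ p : G.graph.Walk x y, p.IsPath ∧ e ∈ p.darts

/-- The nodes that remain connected to the tail of the link `e` when the edge of `e` is removed.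
The nodes on the side of the head are `G.tailSide e.symm`. -/
def tailSide (e : G.graph.Dart) : Set V :=
  {x | (G.graph.deleteEdges {e.edge}).Reachable e.fst x}

/-- The data statistics: how many elements of `R` and of `S` each compute node holds initially. -/
structure Stats where
  sizeR : G.Node → ℕ
  sizeS : G.Node → ℕ

/-- An input: finite sets `R`, `S` over the domain `α`, partitioned among the compute nodes. -/
structure Input (α : Type v) where
  R : G.Node → Finset α
  S : G.Node → Finset α
  disjoint_R : Pairwise fun x y => Disjoint (R x) (R y)
  disjoint_S : Pairwise fun x y => Disjoint (S x) (S y)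

/-- A deterministic algorithm for the network `G`. In round `i`, node `x`, storing the set `X` of
elements (`Sum.inl a` is the element `a` of `R`, `Sum.inr b` the element `b` of `S`), sends the
elements `send i x X y` of `X` to node `y`. The decision depends on the local data `X` only
(the network and the statistics are fixed, hence known). -/
structure Algorithm (α : Type v) where
  rounds : ℕ
  send : ℕ → G.Node → Finset (α ⊕ α) → G.Node → Finset (α ⊕ α)
  send_subset : ∀ i x X y, send i x X y ⊆ X

variable {G} {α : Type v}

/-- The input `I` has the statistics `D`. -/
def Input.HasStats (I : G.Input α) (D : G.Stats) : Prop :=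
  ∀ x, (I.R x).card = D.sizeR x ∧ (I.S x).card = D.sizeS x

namespace Algorithm

open Classical in
/-- The data stored at each compute node after `i` rounds. -/
noncomputable def data (A : G.Algorithm α) (I : G.Input α) : ℕ → G.Node → Finset (α ⊕ α)
  | 0 => fun x => (I.R x).disjSum (I.S x)
  | i + 1 => fun y => A.data I i y ∪ Finset.univ.biUnion fun x => A.send i x (A.data I i x) y

open Classical in
/-- The set of elements that are routed through the link `e` in round `i`. -/
noncomputable def traffic (A : G.Algorithm α) (I : G.Input α) (i : ℕ) (e : G.graph.Dart) :
    Finset (α ⊕ α) :=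
  (Finset.univ.filter fun q : G.Node × G.Node => G.OnRoute q.1 q.2 e).biUnion
    fun q => A.send i q.1 (A.data I i q.1) q.2

/-- The tuple cost: the sum over the rounds of the maximum over the links of the number of
elements routed through the link, divided by its bandwidth. -/
noncomputable def cost (A : G.Algorithm α) (I : G.Input α) : ℝ≥0∞ :=
  ∑ i ∈ Finset.range A.rounds,
    ⨆ e : G.graph.Dart, ((A.traffic I i e).card : ℝ≥0∞) / G.bandwidth e

/-- The algorithm computes `R × S` on the input `I`: at the end, for each pair in `R × S`, some
compute node holds both elements of the pair. -/
def Computes (A : G.Algorithm α) (I : G.Input α) : Prop :=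
  ∀ x y, ∀ a ∈ I.R x, ∀ b ∈ I.S y, ∃ z,
    Sum.inl a ∈ A.data I A.rounds z ∧ Sum.inr b ∈ A.data I A.rounds z

end Algorithm

namespace Stats

variable (D : G.Stats)

open Classical in
/-- The number of elements that the compute nodes in `X` hold initially. -/
noncomputable def sizeOn (X : Set V) : ℕ :=
  ∑ x : G.Node with x.1 ∈ X, (D.sizeR x + D.sizeS x)

/-- The input size `N = |R| + |S|`. -/
def total : ℕ := ∑ x : G.Node, (D.sizeR x + D.sizeS x)

/-- The first lower bound: the maximum over the links `e` of the smaller of the two amounts of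
data that `e` separates, divided by the bandwidth of `e`. -/
noncomputable def edgeBound : ℝ≥0∞ :=
  ⨆ e : G.graph.Dart,
    ((min (D.sizeOn (G.tailSide e)) (D.sizeOn (G.tailSide e.symm)) : ℕ) : ℝ≥0∞) / G.bandwidth e

/-- `r` is the root of the directed tree: each link directed towards `r` goes from a side with at
most as much data to the other side. When no link separates the data into two equal
halves, there is exactly one such `r`. -/
def IsRoot (r : V) : Prop :=
  ∀ e : G.graph.Dart, r ∈ G.tailSide e.symm →
    D.sizeOn (G.tailSide e) ≤ D.sizeOn (G.tailSide e.symm)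

end Stats

variable (G)

/-- In the tree directed towards `r`, each compute node has an ancestor in `U` (each node being an
ancestor of itself). -/
def IsCover (r : V) (U : Finset V) : Prop :=
  ∀ x : G.Node, ∃ t ∈ U, ∃ p : G.graph.Walk x.1 r, p.IsPath ∧ t ∈ p.support

/-- The bandwidth of the link that leaves `x ≠ r` in the tree directed towards `r`. (This link is
unique, so that the supremum has a single term.) -/
noncomputable def outBandwidth (r x : V) : ℝ≥0∞ :=
  ⨆ e : {e : G.graph.Dart // e.fst = x ∧ r ∈ G.tailSide e.symm}, G.bandwidth e.1

variable {G}

/-- The second lower bound: the maximum of `N / √(∑_{x ∈ U} w_x²)` over the minimal covers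
`U ≠ {r}` of the tree directed towards `r`. -/
noncomputable def Stats.coverBound (D : G.Stats) (r : V) : ℝ≥0∞ :=
  ⨆ U : {U : Finset V // Minimal (G.IsCover r) U ∧ U ≠ {r}},
    (D.total : ℝ≥0∞) / (∑ x ∈ U.1, G.outBandwidth r x ^ 2) ^ (1 / 2 : ℝ)

end SymmetricTree

end TopoMPC

/-! For a cost level L let each link e have the integer capacity c(e), the largest k ≤ N with k /
w_e ≤ L (`Stats.capacity`). All comparisons pass through conditions on c (`Stats.Feasible`): the
lighter side of e holds at most 3c(e) elements, and N² ≤ ∑ (3c(e))² over any family of links that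
cuts all compute nodes from the root r. A correct algorithm of cost L makes c feasible
(`Algorithm.Computes.feasible`): the nodes below a link towards r only ever see O(c(e)) elements,
hence O(c(e)²) of the N²/4 pairs. Feasibility bounds L₁ and L₂ by 3L; conversely, these bounds
together with the time for one element, which absorbs rounding, give feasibility
(`Stats.IsRoot.feasible`).

Feasible capacities are met up to a factor 24 in one round (`Stats.Feasible.exists_algorithm`). If r
computes, all data go to r. Otherwise a max-flow min-cut argument (`exists_packing`) allots grid
cells to the compute nodes, at least N² in all and at most (3c(e))² below e. In the lexicographic
order of paths from r the nodes below a link are consecutive, so their cells fit into one interval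
of a Z-order curve, which meets only O(c(e)) rows and columns. Each node receives the rows and
columns of its cells.

Capacities are monotone in L, so the feasible ones form a chain with a least member, common to all
roots (`Stats.exists_feasible_forall_le`). The algorithm built for it, fixed before the input is
known, competes with every B and every root. -/

namespace TopoMPC

namespace SymmetricTree

/-! ### Sides of links, paths, and ancestry in the rooted tree -/

section Tree

variable {V : Type u} (G : SymmetricTree V)

theorem fst_mem_tailSide (e : G.graph.Dart) : e.fst ∈ G.tailSide e :=
  SimpleGraph.Reachable.refl _

theorem snd_mem_tailSide_symm (e : G.graph.Dart) : e.snd ∈ G.tailSide e.symm :=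
  G.fst_mem_tailSide e.symm

theorem mem_tailSide_symm_iff {e : G.graph.Dart} {x : V} :
    x ∈ G.tailSide e.symm ↔ (G.graph.deleteEdges {e.edge}).Reachable e.snd x := by
  simp only [tailSide, SimpleGraph.Dart.edge_symm, Set.mem_ofPred_eq]
  rfl

theorem mem_tailSide_of_adj {e : G.graph.Dart} {x y : V} (hxy : G.graph.Adj x y)
    (hne : s(x, y) ≠ e.edge) (hy : y ∈ G.tailSide e) : x ∈ G.tailSide e := by
  refine SimpleGraph.Reachable.trans hy (SimpleGraph.Adj.reachable ?_)
  rw [SimpleGraph.deleteEdges_adj]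
  exact ⟨hxy.symm, by simpa [Sym2.eq_swap] using hne⟩

theorem disjoint_tailSide_symm (e : G.graph.Dart) :
    Disjoint (G.tailSide e) (G.tailSide e.symm) := by
  rw [Set.disjoint_left]
  intro x h1 h2
  rw [mem_tailSide_symm_iff] at h2
  have hb := SimpleGraph.isAcyclic_iff_forall_isBridge.mp G.isTree.isAcyclic
    (e := e.edge) e.edge_mem
  exact SimpleGraph.isBridge_iff.mp hb (SimpleGraph.Reachable.trans h1 h2.symm)

theorem mem_tailSide_or (e : G.graph.Dart) (x : V) :
    x ∈ G.tailSide e ∨ x ∈ G.tailSide e.symm := by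
  suffices h : ∀ (y : V) (_ : G.graph.Walk x y), y ∈ G.tailSide e ∨ y ∈ G.tailSide e.symm →
      x ∈ G.tailSide e ∨ x ∈ G.tailSide e.symm from
    (G.isTree.connected.preconnected x e.fst).elim fun p => h _ p (Or.inl (G.fst_mem_tailSide e))
  intro y p hy
  induction p with
  | nil => exact hy
  | @cons a b c hab q ih =>
    by_cases hne : s(a, b) = e.edge
    · rcases Sym2.eq_iff.mp hne with ⟨h1, -⟩ | ⟨h1, -⟩
      · exact Or.inl (h1 ▸ G.fst_mem_tailSide e)
      · exact Or.inr (h1 ▸ G.snd_mem_tailSide_symm e)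
    · refine (ih hy).imp (G.mem_tailSide_of_adj hab hne) (G.mem_tailSide_of_adj hab ?_)
      simpa using hne

theorem mem_tailSide_symm_iff_notMem {e : G.graph.Dart} {x : V} :
    x ∈ G.tailSide e.symm ↔ x ∉ G.tailSide e :=
  ⟨fun h h' => Set.disjoint_left.mp (G.disjoint_tailSide_symm e) h' h,
    (G.mem_tailSide_or e x).resolve_left⟩

theorem mem_tailSide_iff_of_adj {e : G.graph.Dart} {x y : V} (hxy : G.graph.Adj x y)
    (hne : s(x, y) ≠ e.edge) : x ∈ G.tailSide e ↔ y ∈ G.tailSide e :=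
  ⟨G.mem_tailSide_of_adj hxy.symm (by rwa [Sym2.eq_swap]), G.mem_tailSide_of_adj hxy hne⟩

theorem mem_tailSide_of_notMem_edges {e : G.graph.Dart} {x y : V} (p : G.graph.Walk x y)
    (he : e.edge ∉ p.edges) : x ∈ G.tailSide e ↔ y ∈ G.tailSide e := by
  induction p with
  | nil => rfl
  | cons hab q ih =>
    rw [SimpleGraph.Walk.edges_cons, List.mem_cons, not_or] at he
    exact (G.mem_tailSide_iff_of_adj hab (Ne.symm he.1)).trans (ih he.2)

theorem mem_tailSide_of_mem_darts {e : G.graph.Dart} {x y : V} (p : G.graph.Walk x y)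
    (hp : p.IsPath) (he : e ∈ p.darts) : x ∈ G.tailSide e ∧ y ∈ G.tailSide e.symm := by
  induction p with
  | nil => simp at he
  | @cons a b c hab q ih =>
    rw [SimpleGraph.Walk.cons_isPath_iff] at hp
    have hfst : ∀ f ∈ q.darts, f.fst ≠ a ∧ f.snd ≠ a := fun f hf =>
      ⟨fun h => hp.2 (h ▸ q.dart_fst_mem_support_of_mem_darts hf),
        fun h => hp.2 (h ▸ q.dart_snd_mem_support_of_mem_darts hf)⟩
    rw [SimpleGraph.Walk.darts_cons, List.mem_cons] at he
    rcases he with rfl | he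
    · refine ⟨G.fst_mem_tailSide _, ?_⟩
      refine (G.mem_tailSide_of_notMem_edges q ?_).mp (G.snd_mem_tailSide_symm _)
      intro h
      exact hp.2 (q.fst_mem_support_of_mem_edges (u := b) (by simpa [Sym2.eq_swap] using h))
    · obtain ⟨h1, h2⟩ := ih hp.1 he
      refine ⟨G.mem_tailSide_of_adj hab (fun h => ?_) h1, h2⟩
      rcases Sym2.eq_iff.mp h with ⟨h, -⟩ | ⟨h, -⟩
      · exact (hfst e he).1 h.symm
      · exact (hfst e he).2 h.symm

/-- A path that avoids the edge stays on one side, and one that uses it backwards starts on the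
wrong side. Routing thus becomes a question about sides only. -/
theorem onRoute_iff {x y : V} {e : G.graph.Dart} :
    G.OnRoute x y e ↔ x ∈ G.tailSide e ∧ y ∈ G.tailSide e.symm := by
  constructor
  · rintro ⟨p, hp, he⟩
    exact G.mem_tailSide_of_mem_darts p hp he
  · rintro ⟨hx, hy⟩
    obtain ⟨p, hp, -⟩ := G.isTree.existsUnique_path x y
    refine ⟨p, hp, ?_⟩
    by_contra he
    have hy' := G.mem_tailSide_symm_iff_notMem.mp hy
    by_cases hmem : e.edge ∈ p.edges
    · obtain ⟨f, hf, hfe⟩ := List.mem_map.mp hmem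
      rcases SimpleGraph.dart_edge_eq_iff f e |>.mp hfe with rfl | rfl
      · exact he hf
      · exact G.mem_tailSide_symm_iff_notMem.mp
          (G.mem_tailSide_of_mem_darts p hp hf).1 hx
    · exact hy' ((G.mem_tailSide_of_notMem_edges p hmem).mp hx)

/-- The list of the nodes on the path of the tree from `r` to `x`. -/
noncomputable def trail (r x : V) : List V :=
  (G.isTree.existsUnique_path r x).choose.support

theorem support_eq_trail {r x : V} {p : G.graph.Walk r x} (hp : p.IsPath) :
    p.support = G.trail r x := by
  rw [trail, (G.isTree.existsUnique_path r x).choose_spec.2 p hp]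

theorem exists_isPath_support_eq_trail (r x : V) :
    ∃ p : G.graph.Walk r x, p.IsPath ∧ p.support = G.trail r x :=
  ⟨_, (G.isTree.existsUnique_path r x).choose_spec.1, rfl⟩

theorem mem_trail_self (r x : V) : x ∈ G.trail r x := by
  obtain ⟨p, -, h⟩ := G.exists_isPath_support_eq_trail r x
  exact h ▸ p.end_mem_support

/-- Encodes ancestry as the prefix order on lists, so that subtrees can later be handled by
lexicographic order. -/
theorem mem_trail_iff_prefix {r t x : V} : t ∈ G.trail r x ↔ G.trail r t <+: G.trail r x := by
  classical
  refine ⟨fun h => ?_, fun h => h.subset (G.mem_trail_self r t)⟩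
  obtain ⟨p, hp, hs⟩ := G.exists_isPath_support_eq_trail r x
  rw [← hs] at h ⊢
  rw [← G.support_eq_trail (hp.takeUntil h)]
  exact p.support_takeUntil_prefix_support h

theorem trail_injective (r : V) : Function.Injective (G.trail r) := by
  intro x y h
  obtain ⟨p, -, hp⟩ := G.exists_isPath_support_eq_trail r x
  obtain ⟨q, -, hq⟩ := G.exists_isPath_support_eq_trail r y
  have h1 := p.getLast_support
  have h2 := q.getLast_support
  rw [← h1, ← h2]
  congr 1
  rw [hp, hq, h]

theorem mem_trail_iff_exists_walk {r t x : V} :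
    t ∈ G.trail r x ↔ ∃ p : G.graph.Walk x r, p.IsPath ∧ t ∈ p.support := by
  constructor
  · intro h
    obtain ⟨p, hp, hs⟩ := G.exists_isPath_support_eq_trail r x
    exact ⟨p.reverse, hp.reverse, by simpa [hs] using h⟩
  · rintro ⟨p, hp, h⟩
    rw [← G.support_eq_trail hp.reverse]
    simpa using h

/-- The nodes below a link directed towards `r` are those whose path to `r` meets its tail. -/
theorem mem_tailSide_iff_mem_trail {r x : V} {e : G.graph.Dart} (hr : r ∈ G.tailSide e.symm) :
    x ∈ G.tailSide e ↔ e.fst ∈ G.trail r x := by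
  classical
  rw [mem_trail_iff_exists_walk]
  constructor
  · intro hx
    obtain ⟨p, hp, he⟩ := G.onRoute_iff.mpr ⟨hx, hr⟩
    exact ⟨p, hp, p.dart_fst_mem_support_of_mem_darts he⟩
  · rintro ⟨p, hp, h⟩
    obtain ⟨q, hq, he⟩ := G.onRoute_iff.mpr ⟨G.fst_mem_tailSide e, hr⟩
    have : q = p.dropUntil e.fst h :=
      (G.isTree.existsUnique_path e.fst r).unique hq (hp.dropUntil h)
    rw [this] at he
    exact (G.mem_tailSide_of_mem_darts p hp (p.darts_dropUntil_subset_darts h he)).1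

theorem isCover_iff {r : V} {U : Finset V} :
    G.IsCover r U ↔ ∀ x : G.Node, ∃ t ∈ U, t ∈ G.trail r x.1 := by
  simp only [IsCover, mem_trail_iff_exists_walk]

/-- Two prefixes of the trail to a common node are comparable; hence the sets below links form a
laminar family. -/
theorem tailSide_subset_or_disjoint {r : V} {e f : G.graph.Dart} (he : r ∈ G.tailSide e.symm)
    (hf : r ∈ G.tailSide f.symm) {x : V} (hxe : x ∈ G.tailSide e) (hxf : x ∈ G.tailSide f) :
    G.tailSide e ⊆ G.tailSide f ∨ G.tailSide f ⊆ G.tailSide e := by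
  rw [G.mem_tailSide_iff_mem_trail he, mem_trail_iff_prefix] at hxe
  rw [G.mem_tailSide_iff_mem_trail hf, mem_trail_iff_prefix] at hxf
  refine (List.prefix_or_prefix_of_prefix hxe hxf).symm.imp (fun h y hy => ?_) (fun h y hy => ?_)
  · rw [G.mem_tailSide_iff_mem_trail he, mem_trail_iff_prefix] at hy
    rw [G.mem_tailSide_iff_mem_trail hf, mem_trail_iff_prefix]
    exact h.trans hy
  · rw [G.mem_tailSide_iff_mem_trail hf, mem_trail_iff_prefix] at hy
    rw [G.mem_tailSide_iff_mem_trail he, mem_trail_iff_prefix]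
    exact h.trans hy

theorem fst_ne_of_mem_tailSide_symm {r : V} {e : G.graph.Dart} (he : r ∈ G.tailSide e.symm) :
    e.fst ≠ r := by
  rintro rfl
  exact G.mem_tailSide_symm_iff_notMem.mp he (G.fst_mem_tailSide e)

theorem exists_dart_fst_eq {r x : V} (h : x ≠ r) :
    ∃ e : G.graph.Dart, e.fst = x ∧ r ∈ G.tailSide e.symm := by
  obtain ⟨p, hp, -⟩ := G.isTree.existsUnique_path x r
  cases p with
  | nil => exact absurd rfl h
  | cons hab q => exact ⟨⟨(_, _), hab⟩, rfl, (G.mem_tailSide_of_mem_darts _ hp (by simp)).2⟩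

theorem dart_eq_of_fst_eq {r : V} {e f : G.graph.Dart} (he : r ∈ G.tailSide e.symm)
    (hf : r ∈ G.tailSide f.symm) (h : e.fst = f.fst) : e = f := by
  have key : ∀ {x y : V} (p : G.graph.Walk x y), p.IsPath → ∀ e ∈ p.darts, ∀ f ∈ p.darts,
      e.fst = x → f.fst = x → e = f := by
    intro x y p hp e he f hf hex hfx
    cases p with
    | nil => simp at he
    | cons hab q =>
      rw [SimpleGraph.Walk.cons_isPath_iff] at hp
      rw [SimpleGraph.Walk.darts_cons, List.mem_cons] at he hf
      rcases he with rfl | he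
      · rcases hf with rfl | hf
        · rfl
        · exact absurd (hfx ▸ q.dart_fst_mem_support_of_mem_darts hf) hp.2
      · exact absurd (hex ▸ q.dart_fst_mem_support_of_mem_darts he) hp.2
  obtain ⟨p, hp, hep⟩ := G.onRoute_iff.mpr ⟨G.fst_mem_tailSide e, he⟩
  obtain ⟨q, hq, hfq⟩ := G.onRoute_iff.mpr ⟨h ▸ G.fst_mem_tailSide f, hf⟩
  obtain rfl := (G.isTree.existsUnique_path e.fst r).unique hp hq
  exact key p hp e hep f hfq rfl h.symm

theorem outBandwidth_fst {r : V} {e : G.graph.Dart} (he : r ∈ G.tailSide e.symm) :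
    G.outBandwidth r e.fst = G.bandwidth e := by
  refine le_antisymm (iSup_le ?_) (le_iSup_of_le ⟨e, rfl, he⟩ le_rfl)
  rintro ⟨f, h, hf⟩
  exact le_of_eq (congrArg G.bandwidth (G.dart_eq_of_fst_eq hf he h))

variable {G} in
theorem Stats.sizeOn_add_sizeOn_symm (D : G.Stats) (e : G.graph.Dart) :
    D.sizeOn (G.tailSide e) + D.sizeOn (G.tailSide e.symm) = D.total := by
  classical
  simp only [Stats.sizeOn, Stats.total, mem_tailSide_symm_iff_notMem]
  convert Finset.sum_filter_add_sum_filter_not (Finset.univ : Finset G.Node)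
    (fun x => x.1 ∈ G.tailSide e) _ using 2

variable {G} in
theorem Stats.sizeOn_mono (D : G.Stats) {X Y : Set V} (h : X ⊆ Y) : D.sizeOn X ≤ D.sizeOn Y := by
  classical
  unfold Stats.sizeOn
  refine Finset.sum_le_sum_of_subset fun x => ?_
  simp only [Finset.mem_filter, Finset.mem_univ, true_and]
  exact fun hx => h hx

variable {G} in
-- Among the links with the strictly heavier side at their tail, take one with the fewest nodes
-- there; its tail is a root, since a violating link would have a strictly smaller tail side.
theorem Stats.exists_isRoot [Finite V] (D : G.Stats) : ∃ r, D.IsRoot r := by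
  by_contra! hno
  unfold Stats.IsRoot at hno
  push Not at hno
  obtain ⟨r₀⟩ := G.isTree.connected.nonempty
  obtain ⟨e₀, -, he₀⟩ := hno r₀
  let H : Set G.graph.Dart :=
    {e | D.sizeOn (G.tailSide e.symm) < D.sizeOn (G.tailSide e)}
  obtain ⟨e, he, hmin⟩ := WellFounded.has_min
    (InvImage.wf (fun e : G.graph.Dart => (G.tailSide e).ncard) Nat.lt_wfRel.wf) H ⟨e₀, he₀⟩
  obtain ⟨f, hf, hfH⟩ := hno e.fst
  have hef : f.edge ≠ e.edge := by
    intro h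
    rcases SimpleGraph.dart_edge_eq_iff f e |>.mp h with rfl | rfl
    · exact G.fst_ne_of_mem_tailSide_symm hf rfl
    · rw [SimpleGraph.Dart.symm_symm] at hfH
      exact lt_asymm hfH he
  have hsum1 := D.sizeOn_add_sizeOn_symm e
  have hsum2 := D.sizeOn_add_sizeOn_symm f
  have he' : D.sizeOn (G.tailSide e.symm) < D.sizeOn (G.tailSide e) := he
  refine hmin f hfH (Set.ncard_lt_ncard ⟨fun y hy => ?_, fun h => ?_⟩ (Set.toFinite _))
  · by_contra hye
    have hye' := G.mem_tailSide_symm_iff_notMem.mpr hye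
    have hr : e.fst ∈ G.tailSide e.symm.symm := by simpa using G.fst_mem_tailSide e
    -- Inclusion one way contradicts the weights (more than half inside less than half); the other
    -- way puts `e.fst` below `f`.
    rcases G.tailSide_subset_or_disjoint hf hr hy hye' with h | h
    · have := D.sizeOn_mono h
      omega
    · have h1 : e.snd ∈ G.tailSide f := h (G.snd_mem_tailSide_symm e)
      exact G.mem_tailSide_symm_iff_notMem.mp hf
        ((G.mem_tailSide_iff_of_adj e.adj (Ne.symm hef)).mpr h1)
  · exact G.mem_tailSide_symm_iff_notMem.mp hf (h (G.fst_mem_tailSide e))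

end Tree

end SymmetricTree

/-! ### The Z-order curve -/

/-- The first coordinate of the `t`-th cell of the Z-order curve: the even binary digits of `t`. -/
def mortonFst (t : ℕ) : ℕ := if t = 0 then 0 else 2 * mortonFst (t / 4) + t % 2
decreasing_by omega

/-- The second coordinate of the `t`-th cell of the Z-order curve: the odd binary digits of `t`. -/
def mortonSnd (t : ℕ) : ℕ := mortonFst (t / 2)

theorem mortonFst_eq (t : ℕ) : mortonFst t = 2 * mortonFst (t / 4) + t % 2 := by
  rcases eq_or_ne t 0 with rfl | h
  · simp [mortonFst]
  · conv_lhs => rw [mortonFst, if_neg h]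

/-- Self-similarity: dropping j base-4 digits of the time drops j binary digits of the coordinate.
-/
theorem mortonFst_div (j t : ℕ) : mortonFst t / 2 ^ j = mortonFst (t / 4 ^ j) := by
  induction j generalizing t with
  | zero => simp
  | succ j ih =>
    rw [pow_succ', ← Nat.div_div_eq_div_mul, pow_succ', ← Nat.div_div_eq_div_mul, ← ih,
      mortonFst_eq t]
    congr 1
    omega

theorem mortonSnd_div (j t : ℕ) : mortonSnd t / 2 ^ j = mortonSnd (t / 4 ^ j) := by
  rw [mortonSnd, mortonFst_div, mortonSnd, Nat.div_div_eq_div_mul, Nat.div_div_eq_div_mul, mul_comm]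

/-- The Z-order curve visits each cell of the square `[0, 2 ^ k)²` before time `4 ^ k`. -/
theorem exists_morton_eq (k a b : ℕ) (ha : a < 2 ^ k) (hb : b < 2 ^ k) :
    ∃ t < 4 ^ k, mortonFst t = a ∧ mortonSnd t = b := by
  induction k generalizing a b with
  | zero =>
    obtain rfl : a = 0 := by simpa using ha
    obtain rfl : b = 0 := by simpa using hb
    exact ⟨0, by simp, by simp [mortonFst], by simp [mortonSnd, mortonFst]⟩
  | succ k ih =>
    obtain ⟨t, ht, hta, htb⟩ := ih (a / 2) (b / 2) (by rw [pow_succ] at ha; omega)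
      (by rw [pow_succ] at hb; omega)
    rw [mortonSnd] at htb
    refine ⟨4 * t + 2 * (b % 2) + a % 2, by rw [pow_succ]; omega, ?_, ?_⟩
    · rw [mortonFst_eq, show (4 * t + 2 * (b % 2) + a % 2) / 4 = t by omega, hta]
      omega
    · rw [mortonSnd, mortonFst_eq,
        show (4 * t + 2 * (b % 2) + a % 2) / 2 / 4 = t / 2 by omega, htb]
      omega

/-- A map that shrinks scale `4 ^ j` to scale `2 ^ j` sends an interval of length at most `4 ^ j`
into a set of `2 * 2 ^ j` numbers. -/
theorem exists_card_le_of_div {f : ℕ → ℕ} (hf : ∀ j t, f t / 2 ^ j = f (t / 4 ^ j)) (j s : ℕ) :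
    ∃ P : Finset ℕ, P.card ≤ 2 * 2 ^ j ∧ ∀ t, s ≤ t → t < s + 4 ^ j → f t ∈ P := by
  classical
  have h4 : 0 < 4 ^ j := by positivity
  have h2 : 0 < 2 ^ j := by positivity
  -- The interval meets at most two aligned blocks of length 4 ^ j, and each block has its image in
  -- one aligned block of length 2 ^ j.
  refine ⟨Finset.Ico (f (s / 4 ^ j) * 2 ^ j) (f (s / 4 ^ j) * 2 ^ j + 2 ^ j) ∪
    Finset.Ico (f (s / 4 ^ j + 1) * 2 ^ j) (f (s / 4 ^ j + 1) * 2 ^ j + 2 ^ j),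
    (Finset.card_union_le _ _).trans (by simp; omega), fun t h1 h3 => ?_⟩
  have hq1 : s / 4 ^ j ≤ t / 4 ^ j := Nat.div_le_div_right h1
  have hq2 : t / 4 ^ j ≤ s / 4 ^ j + 1 := by
    rw [← Nat.add_div_right _ h4]
    exact Nat.div_le_div_right h3.le
  have hd := hf j t
  have hlo := Nat.div_mul_le_self (f t) (2 ^ j)
  have hhi := Nat.lt_div_mul_add h2 (a := f t)
  rw [hd] at hlo hhi
  rw [Finset.mem_union, Finset.mem_Ico, Finset.mem_Ico]
  rcases (show t / 4 ^ j = s / 4 ^ j ∨ t / 4 ^ j = s / 4 ^ j + 1 by omega) with h | h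
  · rw [h] at hlo hhi
    exact Or.inl ⟨hlo, hhi⟩
  · rw [h] at hlo hhi
    exact Or.inr ⟨hlo, hhi⟩

/-! ### Consecutive intervals, lexicographic order, and labels -/

section Intervals

variable {ι β : Type*} [Fintype ι] [LinearOrder β] (key : ι → β) (g : ι → ℕ)

/-- The left end of the interval of length `g i`, when such intervals are laid out
consecutively in the order of the keys. -/
def intervalStart (i : ι) : ℕ := ∑ j with key j < key i, g j

theorem exists_mem_interval (hkey : Function.Injective key) {t : ℕ} (ht : t < ∑ i, g i) :
    ∃ i, intervalStart key g i ≤ t ∧ t < intervalStart key g i + g i := by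
  classical
  have hne : (Finset.univ : Finset ι).Nonempty := by
    rw [Finset.nonempty_iff_ne_empty]
    intro h
    simp [h] at ht
  obtain ⟨m, -, hm⟩ := Finset.exists_min_image Finset.univ key hne
  let T : Finset ι := Finset.univ.filter fun i => intervalStart key g i ≤ t
  have hT : T.Nonempty := by
    refine ⟨m, Finset.mem_filter.mpr ⟨Finset.mem_univ _, ?_⟩⟩
    rw [intervalStart, Finset.filter_false_of_mem, Finset.sum_empty]
    · exact Nat.zero_le _
    · exact fun j hj => not_lt.mpr (hm j hj)
  -- The last interval starting by time t contains t: otherwise the next one would also start by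
  -- then, or the total length would be at most t.
  obtain ⟨i, hiT, hi⟩ := Finset.exists_max_image T key hT
  refine ⟨i, (Finset.mem_filter.mp hiT).2, ?_⟩
  by_contra! hle
  have hsum : intervalStart key g i + g i = ∑ j with key j ≤ key i, g j := by
    rw [intervalStart, add_comm, ← Finset.sum_insert (by simp)]
    congr 1
    ext j
    simp [le_iff_lt_or_eq, hkey.eq_iff, or_comm]
  by_cases hgt : (Finset.univ.filter fun j => key i < key j).Nonempty
  · obtain ⟨k, hk, hkmin⟩ := Finset.exists_min_image _ key hgt
    have hik : key i < key k := (Finset.mem_filter.mp hk).2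
    have hkT : k ∈ T := by
      refine Finset.mem_filter.mpr ⟨Finset.mem_univ _, le_trans (le_of_eq ?_) hle⟩
      rw [hsum, intervalStart]
      congr 1
      ext j
      simp only [Finset.mem_filter, Finset.mem_univ, true_and]
      refine ⟨fun h => not_lt.mp fun h' => ?_, fun h => h.trans_lt hik⟩
      exact (hkmin j (by simpa using h')).not_gt h
    exact (hi k hkT).not_gt hik
  · rw [Finset.not_nonempty_iff_eq_empty, Finset.filter_eq_empty_iff] at hgt
    rw [hsum, Finset.filter_true_of_mem fun j hj => not_lt.mp (hgt hj)] at hle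
    omega

/-- The intervals of a convex set of indices lie in one interval of the total length. -/
theorem exists_interval_of_convex [DecidableEq ι] (T : Finset ι)
    (hT : ∀ a ∈ T, ∀ c ∈ T, ∀ b, key a ≤ key b → key b ≤ key c → b ∈ T) :
    ∃ s, ∀ i ∈ T, s ≤ intervalStart key g i ∧
      intervalStart key g i + g i ≤ s + ∑ j ∈ T, g j := by
  refine ⟨∑ j with ∀ i ∈ T, key j < key i, g j, fun i hi => ⟨?_, ?_⟩⟩
  · refine Finset.sum_le_sum_of_subset fun j hj => ?_
    simp only [Finset.mem_filter, Finset.mem_univ, true_and] at hj ⊢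
    exact hj i hi
  · rw [intervalStart, add_comm, ← Finset.sum_insert (by simp), ← Finset.sum_union]
    · refine Finset.sum_le_sum_of_subset fun j hj => ?_
      by_cases hjT : j ∈ T
      · exact Finset.mem_union_right _ hjT
      · refine Finset.mem_union_left _ ?_
        simp only [Finset.mem_filter, Finset.mem_univ, true_and, Finset.mem_insert] at hj ⊢
        intro a ha
        by_contra! h
        rcases hj with rfl | hj
        · exact hjT hi
        · exact hjT (hT a ha i hi j h hj.le)
    · rw [Finset.disjoint_left]
      intro j hj hjT
      exact lt_irrefl _ ((Finset.mem_filter.mp hj).2 j hjT)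

end Intervals

/-- This makes every subtree convex when nodes are sorted by their trails. -/
theorem prefix_of_le_of_le {β : Type*} [LinearOrder β] {p a b c : List β} (ha : p <+: a)
    (hc : p <+: c) (hab : a ≤ b) (hbc : b ≤ c) : p <+: b := by
  induction p generalizing a b c with
  | nil => exact List.nil_prefix
  | cons h p ih =>
    obtain ⟨a', rfl⟩ := ha
    obtain ⟨c', rfl⟩ := hc
    cases b with
    | nil => exact absurd hab (not_le.mpr (List.Lex.nil : List.Lex (· < ·) [] _))
    | cons k b =>
      rw [List.cons_append] at hab hbc
      have h1 : h ≤ k := by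
        by_contra! hk
        exact absurd hab (not_le.mpr (List.Lex.rel hk : List.Lex (· < ·) _ _))
      have h2 : k ≤ h := by
        by_contra! hk
        exact absurd hbc (not_le.mpr (List.Lex.rel hk : List.Lex (· < ·) _ _))
      obtain rfl := le_antisymm h1 h2
      rw [List.prefix_cons_inj]
      refine ih (List.prefix_append p a') (List.prefix_append p c') ?_ ?_
      · by_contra! hk
        exact absurd hab (not_le.mpr (List.Lex.cons hk : List.Lex (· < ·) _ _))
      · by_contra! hk
        exact absurd hbc (not_le.mpr (List.Lex.cons hk : List.Lex (· < ·) _ _))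

/-- Parties that know the sizes of all sets, but each only the elements of its own set, can
number the elements of all the sets. -/
theorem exists_labelling {ι : Type*} [Fintype ι] (α : Type*) (size : ι → ℕ) :
    ∃ lab : ι → Finset α → α → ℕ, ∀ S : ι → Finset α, (∀ i, (S i).card = size i) →
      (∀ i, ∀ a ∈ S i, lab i (S i) a < ∑ i, size i) ∧
      ∀ i, ∀ a ∈ S i, ∀ j, ∀ b ∈ S j, lab i (S i) a = lab j (S j) b → a = b := by
  classical
  -- The slots depend on the sizes alone, so each party fills its own without communication; the
  -- default 0 below is never used on sets of the right size.
  have φ : (Σ i, Fin (size i)) ≃ Fin (∑ i, size i) := Fintype.equivFinOfCardEq (by simp)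
  refine ⟨fun i s a => if h : a ∈ s ∧ s.card = size i then
    φ ⟨i, Fin.cast h.2 (s.equivFin ⟨a, h.1⟩)⟩ else 0, fun S hS => ⟨fun i a ha => ?_, ?_⟩⟩
  · beta_reduce
    rw [dif_pos ⟨ha, hS i⟩]
    exact Fin.is_lt _
  · intro i a ha j b hb h
    beta_reduce at h
    rw [dif_pos ⟨ha, hS i⟩, dif_pos ⟨hb, hS j⟩, Fin.val_inj, φ.apply_eq_iff_eq,
      Sigma.mk.inj_iff] at h
    obtain ⟨rfl, h⟩ := h
    have h := eq_of_heq h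
    rw [Fin.ext_iff] at h
    simpa [Fin.val_inj] using h

namespace SymmetricTree

/-! ### Every correct algorithm yields feasible capacities -/

section LowerBound

variable {V : Type u} {G : SymmetricTree V} {α : Type v}

open Classical in
/-- The largest number of elements, up to `N`, that the link `e` carries at cost at most `L`. -/
noncomputable def Stats.capacity (D : G.Stats) (L : ℝ≥0∞) (e : G.graph.Dart) : ℕ :=
  Nat.findGreatest (fun k => (k : ℝ≥0∞) / G.bandwidth e ≤ L) D.total

theorem Stats.capacity_div_le (D : G.Stats) (L : ℝ≥0∞) (e : G.graph.Dart) :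
    (D.capacity L e : ℝ≥0∞) / G.bandwidth e ≤ L := by
  classical
  unfold Stats.capacity
  exact Nat.findGreatest_spec (P := fun k : ℕ => (k : ℝ≥0∞) / G.bandwidth e ≤ L)
    (Nat.zero_le _) (by simp)

theorem Stats.le_capacity {D : G.Stats} {L : ℝ≥0∞} {e : G.graph.Dart} {k : ℕ} (hk : k ≤ D.total)
    (h : (k : ℝ≥0∞) / G.bandwidth e ≤ L) : k ≤ D.capacity L e := by
  classical
  exact Nat.le_findGreatest hk h

theorem Stats.capacity_le_total (D : G.Stats) (L : ℝ≥0∞) (e : G.graph.Dart) :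
    D.capacity L e ≤ D.total :=
  Nat.findGreatest_le _

theorem Stats.capacity_mono (D : G.Stats) {L L' : ℝ≥0∞} (h : L ≤ L') (e : G.graph.Dart) :
    D.capacity L e ≤ D.capacity L' e :=
  Stats.le_capacity (D.capacity_le_total L e) ((D.capacity_div_le L e).trans h)

/-- The link capacities `c` satisfy, up to a constant factor, all the constraints that an
algorithm for the statistics `D` puts on them. -/
structure Stats.Feasible (D : G.Stats) (r : V) (c : G.graph.Dart → ℕ) : Prop where
  isRoot : D.IsRoot r
  min_le : ∀ e, min (D.sizeOn (G.tailSide e)) (D.sizeOn (G.tailSide e.symm)) ≤ 3 * c e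
  cover : ∀ W : Finset G.graph.Dart, (∀ e ∈ W, r ∈ G.tailSide e.symm) →
    (∀ x : G.Node, ∃ e ∈ W, x.1 ∈ G.tailSide e) → D.total ^ 2 ≤ ∑ e ∈ W, (3 * c e) ^ 2

theorem Stats.Feasible.sizeOn_tailSide_le {D : G.Stats} {r : V} {c : G.graph.Dart → ℕ}
    (h : D.Feasible r c) {e : G.graph.Dart} (he : r ∈ G.tailSide e.symm) :
    D.sizeOn (G.tailSide e) ≤ 3 * c e :=
  min_eq_left (h.isRoot e he) ▸ h.min_le e

open Classical in
/-- The elements that the nodes in `X` hold initially. -/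
noncomputable def Input.initialOn (I : G.Input α) (X : Set V) : Finset (α ⊕ α) :=
  (Finset.univ.filter fun x : G.Node => x.1 ∈ X).biUnion fun x => (I.R x).disjSum (I.S x)

theorem Input.inl_mem_initialOn {I : G.Input α} {X : Set V} {a : α} :
    Sum.inl a ∈ I.initialOn X ↔ ∃ x : G.Node, x.1 ∈ X ∧ a ∈ I.R x := by
  simp [Input.initialOn]

theorem Input.inr_mem_initialOn {I : G.Input α} {X : Set V} {a : α} :
    Sum.inr a ∈ I.initialOn X ↔ ∃ x : G.Node, x.1 ∈ X ∧ a ∈ I.S x := by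
  simp [Input.initialOn]

theorem Input.card_initialOn_le {I : G.Input α} {D : G.Stats} (hI : I.HasStats D) (X : Set V) :
    (I.initialOn X).card ≤ D.sizeOn X := by
  classical
  refine Finset.card_biUnion_le.trans (le_of_eq ?_)
  unfold Stats.sizeOn
  refine Finset.sum_congr rfl fun x _ => ?_
  rw [Finset.card_disjSum, (hI x).1, (hI x).2]

open Classical in
theorem Input.card_biUnion_R {I : G.Input α} {D : G.Stats} (hI : I.HasStats D)
    (s : Finset G.Node) : (s.biUnion I.R).card = ∑ x ∈ s, D.sizeR x := by
  rw [Finset.card_biUnion fun x _ y _ h => I.disjoint_R h]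
  exact Finset.sum_congr rfl fun x _ => (hI x).1

open Classical in
theorem Input.card_biUnion_S {I : G.Input α} {D : G.Stats} (hI : I.HasStats D)
    (s : Finset G.Node) : (s.biUnion I.S).card = ∑ x ∈ s, D.sizeS x := by
  rw [Finset.card_biUnion fun x _ y _ h => I.disjoint_S h]
  exact Finset.sum_congr rfl fun x _ => (hI x).2

theorem Stats.sizeOn_univ (D : G.Stats) : D.sizeOn Set.univ = D.total := by
  simp [Stats.sizeOn, Stats.total]

namespace Algorithm

variable (B : G.Algorithm α) (I : G.Input α)

theorem data_zero_subset {X : Set V} {x : G.Node} (hx : x.1 ∈ X) :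
    B.data I 0 x ⊆ I.initialOn X := by
  classical
  exact Finset.subset_biUnion_of_mem (fun x => (I.R x).disjSum (I.S x))
    (Finset.mem_filter.mpr ⟨Finset.mem_univ x, hx⟩)

theorem data_subset (i : ℕ) (x : G.Node) : B.data I i x ⊆ I.initialOn Set.univ := by
  classical
  induction i generalizing x with
  | zero => exact B.data_zero_subset I (Set.mem_univ _)
  | succ i ih =>
    refine Finset.union_subset (ih x) (Finset.biUnion_subset.mpr fun y _ => ?_)
    exact (B.send_subset _ _ _ _).trans (ih y)

theorem traffic_subset (i : ℕ) (e : G.graph.Dart) : B.traffic I i e ⊆ I.initialOn Set.univ := by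
  classical
  refine Finset.biUnion_subset.mpr fun q _ => ?_
  exact (B.send_subset _ _ _ _).trans (B.data_subset I i q.1)

theorem traffic_zero_subset (e : G.graph.Dart) :
    B.traffic I 0 e ⊆ I.initialOn (G.tailSide e) := by
  classical
  refine Finset.biUnion_subset.mpr fun q hq => ?_
  exact (B.send_subset _ _ _ _).trans
    (B.data_zero_subset I (G.onRoute_iff.mp (Finset.mem_filter.mp hq).2).1)

open Classical in
/-- The elements that are routed through the link `e` in some round. -/
noncomputable def totalTraffic (e : G.graph.Dart) : Finset (α ⊕ α) :=
  (Finset.range B.rounds).biUnion fun i => B.traffic I i e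

theorem card_totalTraffic_le {D : G.Stats} (hI : I.HasStats D) (e : G.graph.Dart) :
    (B.totalTraffic I e).card ≤ D.capacity (B.cost I) e := by
  classical
  refine Stats.le_capacity ?_ ?_
  · rw [← D.sizeOn_univ]
    exact (Finset.card_le_card (Finset.biUnion_subset.mpr fun i _ => B.traffic_subset I i e)).trans
      (Input.card_initialOn_le hI _)
  · have h : ((B.totalTraffic I e).card : ℝ≥0∞) ≤
        ∑ i ∈ Finset.range B.rounds, ((B.traffic I i e).card : ℝ≥0∞) := by
      exact_mod_cast Finset.card_biUnion_le
    calc ((B.totalTraffic I e).card : ℝ≥0∞) / G.bandwidth e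
        ≤ (∑ i ∈ Finset.range B.rounds, ((B.traffic I i e).card : ℝ≥0∞)) / G.bandwidth e :=
          ENNReal.div_le_div_right h _
      _ = ∑ i ∈ Finset.range B.rounds, ((B.traffic I i e).card : ℝ≥0∞) / G.bandwidth e := by
          simp only [div_eq_mul_inv, Finset.sum_mul]
      _ ≤ B.cost I := Finset.sum_le_sum fun i _ =>
          le_iSup (fun e => ((B.traffic I i e).card : ℝ≥0∞) / G.bandwidth e) e

open Classical in
/-- What a node stores was on its side of a link initially, or has crossed the link. -/
theorem data_subset_union {e : G.graph.Dart} {i : ℕ} (hi : i ≤ B.rounds) {x : G.Node}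
    (hx : x.1 ∈ G.tailSide e.symm) :
    B.data I i x ⊆ I.initialOn (G.tailSide e.symm) ∪ B.totalTraffic I e := by
  induction i generalizing x with
  | zero => exact (B.data_zero_subset I hx).trans Finset.subset_union_left
  | succ i ih =>
    refine Finset.union_subset (ih (Nat.le_of_succ_le hi) hx)
      (Finset.biUnion_subset.mpr fun y _ => ?_)
    rcases G.mem_tailSide_or e y.1 with hy | hy
    · refine Finset.Subset.trans ?_ Finset.subset_union_right
      refine Finset.Subset.trans ?_ (Finset.subset_biUnion_of_mem _ (Finset.mem_range.mpr hi))
      exact Finset.subset_biUnion_of_mem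
        (fun q : G.Node × G.Node => B.send i q.1 (B.data I i q.1) q.2)
        (Finset.mem_filter.mpr ⟨Finset.mem_univ (y, x), G.onRoute_iff.mpr ⟨hy, hx⟩⟩)
    · exact (B.send_subset _ _ _ _).trans (ih (Nat.le_of_succ_le hi) hy)

open Classical in
variable {B I} in
/-- If some `a ∈ R` and `b ∈ S` start on different sides of a link, one of the two crosses it. -/
theorem Computes.mem_totalTraffic_or (hB : B.Computes I) {e : G.graph.Dart} {x y : G.Node}
    (hx : x.1 ∈ G.tailSide e) (hy : y.1 ∈ G.tailSide e.symm) {a b : α} (ha : a ∈ I.R x)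
    (hb : b ∈ I.S y) :
    Sum.inl a ∈ B.totalTraffic I e ∨ Sum.inr b ∈ B.totalTraffic I e.symm := by
  have hxy : ∀ {x' : G.Node}, x'.1 ∈ G.tailSide e.symm → x ≠ x' := by
    rintro x' h rfl
    exact G.mem_tailSide_symm_iff_notMem.mp h hx
  have hyx : ∀ {y' : G.Node}, y'.1 ∈ G.tailSide e → y ≠ y' := by
    rintro y' h rfl
    exact G.mem_tailSide_symm_iff_notMem.mp hy h
  obtain ⟨z, hza, hzb⟩ := hB x y a ha b hb
  rcases G.mem_tailSide_or e z.1 with hz | hz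
  · right
    have hz' : z.1 ∈ G.tailSide e.symm.symm := by simpa using hz
    refine (Finset.mem_union.mp (B.data_subset_union I le_rfl hz' hzb)).resolve_left fun h => ?_
    obtain ⟨y', hy', hb'⟩ := Input.inr_mem_initialOn.mp h
    rw [SimpleGraph.Dart.symm_symm] at hy'
    exact Finset.disjoint_left.mp (I.disjoint_S (hyx hy')) hb hb'
  · left
    refine (Finset.mem_union.mp (B.data_subset_union I le_rfl hz hza)).resolve_left fun h => ?_
    obtain ⟨x', hx', ha'⟩ := Input.inl_mem_initialOn.mp h
    exact Finset.disjoint_left.mp (I.disjoint_R (hxy hx')) ha ha'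

end Algorithm

theorem Stats.capacity_symm (D : G.Stats) (L : ℝ≥0∞) (e : G.graph.Dart) :
    D.capacity L e.symm = D.capacity L e := by
  simp only [Stats.capacity, G.bandwidth_symm]

open Classical in
-- If both sums exceeded the capacity, some `a` behind the link and some `b` beyond it would never
-- cross, and so never meet.
theorem Algorithm.Computes.sizeR_le_or_sizeS_le {B : G.Algorithm α} {I : G.Input α}
    (hB : B.Computes I) {D : G.Stats} (hI : I.HasStats D) (e : G.graph.Dart) :
    ∑ x : G.Node with x.1 ∈ G.tailSide e, D.sizeR x ≤ D.capacity (B.cost I) e ∨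
      ∑ x : G.Node with x.1 ∈ G.tailSide e.symm, D.sizeS x ≤ D.capacity (B.cost I) e := by
  have hc := B.card_totalTraffic_le I hI e
  have hc' := B.card_totalTraffic_le I hI e.symm
  rw [D.capacity_symm] at hc'
  by_contra! h
  rw [← Input.card_biUnion_R hI, ← Input.card_biUnion_S hI] at h
  have h1 : (B.totalTraffic I e).toLeft.card ≤ (B.totalTraffic I e).card :=
    Finset.card_toLeft_le
  have h2 : (B.totalTraffic I e.symm).toRight.card ≤ (B.totalTraffic I e.symm).card :=
    Finset.card_toRight_le
  obtain ⟨a, ha, ha'⟩ := Finset.exists_mem_notMem_of_card_lt_card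
    (h1.trans_lt (hc.trans_lt h.1))
  obtain ⟨b, hb, hb'⟩ := Finset.exists_mem_notMem_of_card_lt_card
    (h2.trans_lt (hc'.trans_lt h.2))
  simp only [Finset.mem_biUnion, Finset.mem_filter, Finset.mem_univ, true_and] at ha hb
  obtain ⟨x, hx, hax⟩ := ha
  obtain ⟨y, hy, hby⟩ := hb
  rw [Finset.mem_toLeft] at ha'
  rw [Finset.mem_toRight] at hb'
  exact (hB.mem_totalTraffic_or hx hy hax hby).elim ha' hb'

/-- Apply the previous dichotomy in both directions. Either one side has few elements of both sets,
or one whole set has size at most twice the capacity; then |R| = |S| bounds half of N. -/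
theorem Algorithm.Computes.min_sizeOn_le {B : G.Algorithm α} {I : G.Input α}
    (hB : B.Computes I) {D : G.Stats} (hI : I.HasStats D)
    (hRS : ∑ x, D.sizeR x = ∑ x, D.sizeS x) (e : G.graph.Dart) :
    min (D.sizeOn (G.tailSide e)) (D.sizeOn (G.tailSide e.symm)) ≤
      2 * D.capacity (B.cost I) e := by
  classical
  have h1 := hB.sizeR_le_or_sizeS_le hI e
  have h2 := hB.sizeR_le_or_sizeS_le hI e.symm
  have hsplit : ∀ f : G.Node → ℕ, ∑ x : G.Node with x.1 ∈ G.tailSide e, f x +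
      ∑ x : G.Node with x.1 ∈ G.tailSide e.symm, f x = ∑ x, f x := by
    intro f
    simp only [G.mem_tailSide_symm_iff_notMem]
    exact Finset.sum_filter_add_sum_filter_not _ _ _
  have hR := hsplit D.sizeR
  have hS := hsplit D.sizeS
  rw [SimpleGraph.Dart.symm_symm, D.capacity_symm] at h2
  simp only [Stats.sizeOn, Finset.sum_add_distrib]
  omega

theorem Stats.total_eq (D : G.Stats) :
    D.total = ∑ x, D.sizeR x + ∑ x, D.sizeS x := Finset.sum_add_distrib

/-- The cost of each algorithm yields feasible link capacities. -/
theorem Algorithm.Computes.feasible {B : G.Algorithm α} {I : G.Input α}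
    (hB : B.Computes I) {D : G.Stats} (hI : I.HasStats D)
    (hRS : ∑ x, D.sizeR x = ∑ x, D.sizeS x) {r : V} (hr : D.IsRoot r) :
    D.Feasible r (D.capacity (B.cost I)) := by
  classical
  have hmin := hB.min_sizeOn_le hI hRS
  refine ⟨hr, fun e => (hmin e).trans (by omega), fun W hW hcov => ?_⟩
  -- All that the nodes below `e` can ever hold: at most 2c initially and c arriving, whence the
  -- constant 3.
  let T : G.graph.Dart → Finset (α ⊕ α) := fun e =>
    I.initialOn (G.tailSide e) ∪ B.totalTraffic I e.symm
  have hT : ∀ e ∈ W, (T e).card ≤ 3 * D.capacity (B.cost I) e := by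
    intro e he
    have h1 := hmin e
    rw [min_eq_left (hr e (hW e he))] at h1
    have h2 := B.card_totalTraffic_le I hI e.symm
    rw [D.capacity_symm] at h2
    have h3 := Input.card_initialOn_le hI (G.tailSide e)
    have h4 : (T e).card ≤ _ := Finset.card_union_le _ _
    omega
  have hsub : (Finset.univ.biUnion I.R) ×ˢ (Finset.univ.biUnion I.S) ⊆
      W.biUnion fun e => (T e).toLeft ×ˢ (T e).toRight := by
    rintro ⟨a, b⟩ hab
    simp only [Finset.mem_product, Finset.mem_biUnion, Finset.mem_univ, true_and] at hab
    obtain ⟨⟨x, ha⟩, y, hb⟩ := hab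
    obtain ⟨z, hza, hzb⟩ := hB x y a ha b hb
    obtain ⟨e, he, hz⟩ := hcov z
    have hz' : z.1 ∈ G.tailSide e.symm.symm := by simpa using hz
    have hd := B.data_subset_union I le_rfl hz'
    rw [SimpleGraph.Dart.symm_symm] at hd
    exact Finset.mem_biUnion.mpr ⟨e, he, Finset.mem_product.mpr
      ⟨Finset.mem_toLeft.mpr (hd hza), Finset.mem_toRight.mpr (hd hzb)⟩⟩
  have hcard := (Finset.card_le_card hsub).trans Finset.card_biUnion_le
  rw [Finset.card_product, Input.card_biUnion_R hI, Input.card_biUnion_S hI, ← hRS] at hcard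
  have htot := D.total_eq
  rw [← hRS] at htot
  -- There are N²/4 pairs, and p + q ≤ 3c gives 4pq ≤ (3c)².
  calc D.total ^ 2 = 4 * ((∑ x, D.sizeR x) * ∑ x, D.sizeR x) := by rw [htot]; ring
    _ ≤ 4 * ∑ e ∈ W, ((T e).toLeft ×ˢ (T e).toRight).card := Nat.mul_le_mul_left _ hcard
    _ = ∑ e ∈ W, 4 * ((T e).toLeft ×ˢ (T e).toRight).card := Finset.mul_sum _ _ _
    _ ≤ ∑ e ∈ W, (3 * D.capacity (B.cost I) e) ^ 2 := by
      refine Finset.sum_le_sum fun e he => ?_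
      rw [Finset.card_product]
      refine le_trans ?_ (Nat.pow_le_pow_left (hT e he) 2)
      rw [← Finset.card_toLeft_add_card_toRight (u := T e), ← mul_assoc]
      exact four_mul_le_sq_add _ _

end LowerBound

/-! ### Feasibility versus the explicit lower bounds -/

section Bounds

/-- Insert c ≤ L w and take square roots. An infinite bandwidth makes the left side 0. -/
theorem natCast_div_rpow_le {ι : Type*} {s : Finset ι} {N K : ℕ} {c : ι → ℕ} {w : ι → ℝ≥0∞}
    {L : ℝ≥0∞} (hK : K ≠ 0) (hN : N ^ 2 ≤ ∑ i ∈ s, (K * c i) ^ 2)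
    (hc : ∀ i ∈ s, (c i : ℝ≥0∞) / w i ≤ L) :
    (N : ℝ≥0∞) / (∑ i ∈ s, w i ^ 2) ^ (1 / 2 : ℝ) ≤ K * L := by
  rcases eq_or_ne L ⊤ with rfl | hL
  · rw [ENNReal.mul_top (by exact_mod_cast hK)]
    exact le_top
  by_cases hw : ∃ i ∈ s, w i = ⊤
  · obtain ⟨i, hi, hwi⟩ := hw
    have : ∑ i ∈ s, w i ^ 2 = ⊤ := ENNReal.sum_eq_top.mpr ⟨i, hi, by simp [hwi]⟩
    rw [this, ENNReal.top_rpow_of_pos (by norm_num), ENNReal.div_top]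
    exact zero_le
  push Not at hw
  have hsq : (N : ℝ≥0∞) ^ 2 ≤ (K * L) ^ 2 * ∑ i ∈ s, w i ^ 2 := by
    calc (N : ℝ≥0∞) ^ 2 ≤ ∑ i ∈ s, ((K : ℝ≥0∞) * c i) ^ 2 := by exact_mod_cast hN
      _ ≤ ∑ i ∈ s, ((K : ℝ≥0∞) * (L * w i)) ^ 2 := by
        refine Finset.sum_le_sum fun i hi => ?_
        have := (ENNReal.div_le_iff_le_mul (Or.inr hL) (Or.inl (hw i hi))).mp (hc i hi)
        gcongr
      _ = (K * L) ^ 2 * ∑ i ∈ s, w i ^ 2 := by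
        rw [Finset.mul_sum]
        exact Finset.sum_congr rfl fun i _ => by ring
  refine ENNReal.div_le_of_le_mul ?_
  have h := ENNReal.rpow_le_rpow hsq (by norm_num : (0 : ℝ) ≤ 1 / 2)
  rw [ENNReal.mul_rpow_of_nonneg _ _ (by norm_num)] at h
  simpa only [← ENNReal.rpow_natCast, ← ENNReal.rpow_mul, Nat.cast_ofNat, mul_one_div,
    div_self (two_ne_zero (α := ℝ)), ENNReal.rpow_one] using h

variable {V : Type u} {G : SymmetricTree V}

/-- Unless a capacity reaches N, L w < c + 1 up to division by w; since one element fits, c ≥ 1, so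
rounding down costs at most a factor 2. -/
theorem Stats.sq_total_le_sum_capacity {D : G.Stats} {L : ℝ≥0∞} {W : Finset G.graph.Dart}
    (hW : W.Nonempty)
    (hL : (D.total : ℝ≥0∞) / (∑ e ∈ W, G.bandwidth e ^ 2) ^ (1 / 2 : ℝ) ≤ L)
    (hone : ∀ e ∈ W, 1 / G.bandwidth e ≤ L) :
    D.total ^ 2 ≤ ∑ e ∈ W, (3 * D.capacity L e) ^ 2 := by
  rcases Nat.eq_zero_or_pos D.total with h0 | hpos
  · simp [h0]
  by_cases hfull : ∃ e ∈ W, D.capacity L e = D.total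
  · obtain ⟨e, he, h⟩ := hfull
    refine le_trans ?_ (Finset.single_le_sum (fun e _ => Nat.zero_le _) he)
    rw [h]
    exact Nat.pow_le_pow_left (by omega) 2
  push Not at hfull
  have hlt : ∀ e ∈ W, L < ((D.capacity L e + 1 : ℕ) : ℝ≥0∞) / G.bandwidth e := by
    intro e he
    by_contra! h
    have := Stats.le_capacity (lt_of_le_of_ne (D.capacity_le_total L e) (hfull e he)) h
    omega
  obtain ⟨e₀, he₀⟩ := hW
  have hLtop : L ≠ ⊤ := (hlt e₀ he₀).ne_top
  have hwtop : ∀ e ∈ W, G.bandwidth e ≠ ⊤ := by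
    intro e he h
    have := hlt e he
    rw [h, ENNReal.div_top] at this
    exact not_lt_zero this
  have hmul : ∀ e ∈ W, L * G.bandwidth e ≤ ((2 * D.capacity L e : ℕ) : ℝ≥0∞) := by
    intro e he
    have h1 : 1 ≤ D.capacity L e := Stats.le_capacity hpos (by simpa using hone e he)
    refine le_trans (ENNReal.mul_le_of_le_div (hlt e he).le) ?_
    exact_mod_cast (by omega : D.capacity L e + 1 ≤ 2 * D.capacity L e)
  have hStop : (∑ e ∈ W, G.bandwidth e ^ 2) ^ (1 / 2 : ℝ) ≠ ⊤ := by
    refine ENNReal.rpow_ne_top_of_nonneg (by norm_num) ?_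
    exact ENNReal.sum_ne_top.mpr fun e he => ENNReal.pow_ne_top (hwtop e he)
  have hN := (ENNReal.div_le_iff_le_mul (Or.inr hLtop) (Or.inl hStop)).mp hL
  have hsq : (D.total : ℝ≥0∞) ^ 2 ≤ ∑ e ∈ W, (((3 * D.capacity L e : ℕ) : ℝ≥0∞)) ^ 2 := by
    calc (D.total : ℝ≥0∞) ^ 2
        ≤ (L * (∑ e ∈ W, G.bandwidth e ^ 2) ^ (1 / 2 : ℝ)) ^ 2 := by gcongr
      _ = ∑ e ∈ W, (L * G.bandwidth e) ^ 2 := by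
        rw [mul_pow, ← ENNReal.rpow_natCast (_ ^ (1 / 2 : ℝ)), ← ENNReal.rpow_mul]
        norm_num
        rw [Finset.mul_sum]
        exact Finset.sum_congr rfl fun e _ => (mul_pow _ _ _).symm
      _ ≤ _ := by
        refine Finset.sum_le_sum fun e he => ?_
        have h : 2 * D.capacity L e ≤ 3 * D.capacity L e := by omega
        have := (hmul e he).trans (Nat.cast_le.mpr h)
        gcongr
  exact_mod_cast hsq

open Classical in
theorem sum_outBandwidth_image_fst {r : V} {W : Finset G.graph.Dart}
    (hW : ∀ e ∈ W, r ∈ G.tailSide e.symm) :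
    ∑ x ∈ W.image (fun e => e.fst), G.outBandwidth r x ^ 2 = ∑ e ∈ W, G.bandwidth e ^ 2 := by
  rw [Finset.sum_image fun e he f hf h => G.dart_eq_of_fst_eq (hW e he) (hW f hf) h]
  exact Finset.sum_congr rfl fun e he => by rw [G.outBandwidth_fst (hW e he)]

theorem Stats.Feasible.edgeBound_le {D : G.Stats} {r : V} {L : ℝ≥0∞}
    (h : D.Feasible r (D.capacity L)) : D.edgeBound ≤ 3 * L := by
  refine iSup_le fun e => ?_
  calc _ ≤ ((3 * D.capacity L e : ℕ) : ℝ≥0∞) / G.bandwidth e :=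
        ENNReal.div_le_div_right (Nat.cast_le.mpr (h.min_le e)) _
    _ = 3 * ((D.capacity L e : ℝ≥0∞) / G.bandwidth e) := by
        rw [Nat.cast_mul, mul_div_assoc, Nat.cast_ofNat]
    _ ≤ 3 * L := by
        gcongr
        exact D.capacity_div_le L e

theorem notMem_of_minimal_isCover {r : V} {U : Finset V} (hU : Minimal (G.IsCover r) U)
    (hne : U ≠ {r}) : r ∉ U := by
  intro hr
  refine hne (hU.eq_of_le (G.isCover_iff.mpr fun x => ⟨r, by simp, ?_⟩)
    (Finset.singleton_subset_iff.mpr hr)).symm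
  obtain ⟨p, -, hp⟩ := G.exists_isPath_support_eq_trail r x
  exact hp ▸ p.start_mem_support

theorem Stats.Feasible.coverBound_le [Finite V] {D : G.Stats} {r : V} {L : ℝ≥0∞}
    (h : D.Feasible r (D.capacity L)) : D.coverBound r ≤ 3 * L := by
  classical
  have := Fintype.ofFinite V
  refine iSup_le ?_
  rintro ⟨U, hU, hne⟩
  have hr := notMem_of_minimal_isCover hU hne
  let W : Finset G.graph.Dart :=
    Finset.univ.filter fun e => r ∈ G.tailSide e.symm ∧ e.fst ∈ U
  have hW : ∀ e ∈ W, r ∈ G.tailSide e.symm := fun e he => (Finset.mem_filter.mp he).2.1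
  have hWU : W.image (fun e => e.fst) = U := by
    ext x
    rw [Finset.mem_image]
    constructor
    · rintro ⟨e, he, rfl⟩
      exact (Finset.mem_filter.mp he).2.2
    · intro hx
      obtain ⟨e, he, her⟩ := G.exists_dart_fst_eq (x := x) (r := r) (by rintro rfl; exact hr hx)
      exact ⟨e, Finset.mem_filter.mpr ⟨Finset.mem_univ _, her, he ▸ hx⟩, he⟩
  simp only
  rw [← hWU, sum_outBandwidth_image_fst hW]
  refine natCast_div_rpow_le (K := 3) (by norm_num) (h.cover W hW fun x => ?_)
    fun e _ => D.capacity_div_le L e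
  obtain ⟨t, ht, htx⟩ := G.isCover_iff.mp hU.prop x
  rw [← hWU, Finset.mem_image] at ht
  obtain ⟨e, he, rfl⟩ := ht
  exact ⟨e, he, (G.mem_tailSide_iff_mem_trail (hW e he)).mpr htx⟩

/-- The two lower bounds, and the time to send one element, yield feasible link capacities. -/
theorem Stats.IsRoot.feasible {D : G.Stats} {r : V} (hr : D.IsRoot r) {L : ℝ≥0∞}
    (hedge : D.edgeBound ≤ L) (hcover : D.coverBound r ≤ L)
    (hone : ∀ e : G.graph.Dart, 1 / G.bandwidth e ≤ L) : D.Feasible r (D.capacity L) := by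
  classical
  refine ⟨hr, fun e => ?_, fun W hW hcov => ?_⟩
  · refine (Stats.le_capacity (D := D) (L := L) ?_ ((le_iSup _ e).trans hedge)).trans (by omega)
    have := D.sizeOn_add_sizeOn_symm e
    omega
  · rcases W.eq_empty_or_nonempty with rfl | hne
    · have : IsEmpty G.Node := ⟨fun x => by simpa using hcov x⟩
      simp [Stats.total]
    refine Stats.sq_total_le_sum_capacity hne ?_ fun e _ => hone e
    -- The bound speaks of minimal covers only; shrinking a cover decreases the denominator, so
    -- nothing is lost.
    obtain ⟨U, hUW, hU⟩ := exists_minimal_le_of_wellFoundedLT (G.IsCover r)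
      (W.image fun e => e.fst) (G.isCover_iff.mpr fun x => by
        obtain ⟨e, he, hx⟩ := hcov x
        exact ⟨e.fst, Finset.mem_image_of_mem _ he,
          (G.mem_tailSide_iff_mem_trail (hW e he)).mp hx⟩)
    have hrU : U ≠ {r} := by
      rintro rfl
      obtain ⟨e, he, her⟩ := Finset.mem_image.mp (hUW (Finset.mem_singleton_self r))
      exact G.fst_ne_of_mem_tailSide_symm (hW e he) her
    refine le_trans ?_ ((le_iSup (fun U : {U : Finset V // Minimal (G.IsCover r) U ∧ U ≠ {r}} =>
      (D.total : ℝ≥0∞) / (∑ x ∈ U.1, G.outBandwidth r x ^ 2) ^ (1 / 2 : ℝ))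
      ⟨U, hU, hrU⟩).trans hcover)
    refine ENNReal.div_le_div_left (ENNReal.rpow_le_rpow ?_ (by norm_num)) _
    rw [← sum_outBandwidth_image_fst hW]
    exact Finset.sum_le_sum_of_subset hUW

end Bounds

/-! ### Feasible capacities yield a one-round algorithm -/

section UpperBound

variable {V : Type u} {G : SymmetricTree V} {α : Type v}

open Classical in
/-- If the nodes below each link towards `r` may hold at most `cap e` units together, and each
family of links that separates all compute nodes from `r` has capacity at least `M`, then the
compute nodes can hold at least `M` units. -/
theorem exists_packing [Finite V] {r : V} (hr : r ∉ G.compute) (cap : G.graph.Dart → ℕ) {M : ℕ}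
    (hM : ∀ W : Finset G.graph.Dart, (∀ e ∈ W, r ∈ G.tailSide e.symm) →
      (∀ x : G.Node, ∃ e ∈ W, x.1 ∈ G.tailSide e) → M ≤ ∑ e ∈ W, cap e) :
    ∃ g : G.Node → ℕ, (∀ e : G.graph.Dart, r ∈ G.tailSide e.symm →
      ∑ x : G.Node with x.1 ∈ G.tailSide e, g x ≤ cap e) ∧ M ≤ ∑ x, g x := by
  have := Fintype.ofFinite V
  let K : Set (G.Node → ℕ) := {g | ∀ e : G.graph.Dart, r ∈ G.tailSide e.symm →
      ∑ x : G.Node with x.1 ∈ G.tailSide e, g x ≤ cap e}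
  have hout : ∀ x : G.Node, ∃ e : G.graph.Dart, e.fst = x.1 ∧ r ∈ G.tailSide e.symm := fun x =>
    G.exists_dart_fst_eq (by rintro rfl; exact hr x.2)
  choose out hfst hout using hout
  have hbdd : BddAbove ((fun g : G.Node → ℕ => ∑ x, g x) '' K) := by
    refine ⟨∑ x, cap (out x), ?_⟩
    rintro _ ⟨g, hg, rfl⟩
    refine Finset.sum_le_sum fun x _ => le_trans ?_ (hg (out x) (hout x))
    refine Finset.single_le_sum (f := g) (fun _ _ => Nat.zero_le _) ?_
    exact Finset.mem_filter.mpr ⟨Finset.mem_univ _, hfst x ▸ G.fst_mem_tailSide _⟩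
  obtain ⟨g, hg, hgmax⟩ := Nat.sSup_mem
    (Set.Nonempty.image (fun g : G.Node → ℕ => ∑ x, g x) (s := K) ⟨0, fun e _ => by simp⟩) hbdd
  refine ⟨g, hg, ?_⟩
  let IsCov : Finset G.graph.Dart → Prop := fun W =>
    ∀ x : G.Node, ∃ e ∈ W, x.1 ∈ G.tailSide e
  -- The saturated links for a maximal packing: a compute node below none of them could take one
  -- more unit.
  let W₀ : Finset G.graph.Dart := Finset.univ.filter fun e => r ∈ G.tailSide e.symm ∧
    cap e ≤ ∑ x : G.Node with x.1 ∈ G.tailSide e, g x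
  have hW₀ : IsCov W₀ := by
    intro x
    by_contra! hx
    have hg' : g + Pi.single x 1 ∈ K := by
      intro e he
      simp only [Pi.add_apply, Finset.sum_add_distrib]
      by_cases hxe : x.1 ∈ G.tailSide e
      · have hlt : ∑ x : G.Node with x.1 ∈ G.tailSide e, g x < cap e := by
          by_contra! h
          exact hx e (Finset.mem_filter.mpr ⟨Finset.mem_univ _, he, h⟩) hxe
        have h1 : ∑ y : G.Node with y.1 ∈ G.tailSide e, (Pi.single x 1 : G.Node → ℕ) y ≤ 1 := by
          rw [Finset.sum_pi_single']
          split_ifs <;> simp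
        omega
      · rw [Finset.sum_pi_single', if_neg (by simpa using hxe)]
        exact hg e he
    have := le_csSup hbdd ⟨_, hg', rfl⟩
    rw [← hgmax] at this
    simp [Finset.sum_add_distrib] at this
  -- By laminarity a minimal cover has disjoint sets below its links, so their saturated loads add
  -- up without overlap.
  obtain ⟨W, hWW₀, hW⟩ := exists_minimal_le_of_wellFoundedLT IsCov W₀ hW₀
  have hmem : ∀ e ∈ W, r ∈ G.tailSide e.symm ∧
      cap e ≤ ∑ x : G.Node with x.1 ∈ G.tailSide e, g x := fun e he =>
    (Finset.mem_filter.mp (hWW₀ he)).2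
  have hnot : ∀ e ∈ W, ∀ f ∈ W, e ≠ f → ¬ G.tailSide e ⊆ G.tailSide f := by
    intro e he f hf hne hsub
    refine (Finset.erase_ssubset he).not_ge (hW.le_of_le (fun x => ?_) (Finset.erase_subset e W))
    obtain ⟨d, hd, hx⟩ := hW.prop x
    by_cases hde : d = e
    · exact ⟨f, Finset.mem_erase.mpr ⟨hne.symm, hf⟩, hsub (hde ▸ hx)⟩
    · exact ⟨d, Finset.mem_erase.mpr ⟨hde, hd⟩, hx⟩
  calc M ≤ ∑ e ∈ W, cap e := hM W (fun e he => (hmem e he).1) hW.prop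
    _ ≤ ∑ e ∈ W, ∑ x : G.Node with x.1 ∈ G.tailSide e, g x :=
      Finset.sum_le_sum fun e he => (hmem e he).2
    _ = ∑ x ∈ W.biUnion fun e => Finset.univ.filter fun x : G.Node => x.1 ∈ G.tailSide e, g x := by
      refine (Finset.sum_biUnion fun e he f hf hne => ?_).symm
      refine Finset.disjoint_left.mpr fun x hxe hxf => ?_
      rcases G.tailSide_subset_or_disjoint (hmem e he).1 (hmem f hf).1
        (Finset.mem_filter.mp hxe).2 (Finset.mem_filter.mp hxf).2 with h | h
      · exact hnot e he f hf hne h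
      · exact hnot f hf e he hne.symm h
    _ ≤ ∑ x, g x := Finset.sum_le_sum_of_subset (Finset.subset_univ _)

/-- Feasible link capacities allow to cover the grid of all pairs by rectangles, one for each
compute node, such that the rectangles below each link project to few rows and columns. -/
theorem Stats.Feasible.exists_rectangles [Finite V] {D : G.Stats} {r : V}
    {c : G.graph.Dart → ℕ} (h : D.Feasible r c) :
    ∃ A B : G.Node → Set ℕ,
      (∀ a b, 2 * a < D.total → 2 * b < D.total → ∃ z, a ∈ A z ∧ b ∈ B z) ∧
      ∀ e : G.graph.Dart, r ∈ G.tailSide e.symm → ∃ P Q : Finset ℕ, P.card ≤ 12 * c e ∧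
        Q.card ≤ 12 * c e ∧ ∀ z : G.Node, z.1 ∈ G.tailSide e → A z ⊆ P ∧ B z ⊆ Q := by
  classical
  by_cases hr : r ∈ G.compute
  -- A root that computes takes the whole grid, and no cell lies below any link.
  · refine ⟨fun z => {_n | z.1 = r}, fun z => {_n | z.1 = r},
      fun _ _ _ _ => ⟨⟨r, hr⟩, rfl, rfl⟩, fun e he => ⟨∅, ∅, by simp, by simp, fun z hz => ?_⟩⟩
    have hzr : z.1 ≠ r := by
      rintro rfl
      exact G.mem_tailSide_symm_iff_notMem.mp he hz
    simp [hzr]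
  obtain ⟨g, hg, hsum⟩ := exists_packing hr (fun e => (3 * c e) ^ 2) h.cover
  -- Any order on the vertices will do; it only serves to compare trails lexicographically.
  let _ : LinearOrder V := LinearOrder.lift' (Finite.equivFin V) (Finite.equivFin V).injective
  let key : G.Node → List V := fun z => G.trail r z.1
  have hkey : Function.Injective key := (G.trail_injective r).comp Subtype.val_injective
  let J : G.Node → Set ℕ := fun z =>
    Set.Ico (intervalStart key g z) (intervalStart key g z + g z)
  refine ⟨fun z => mortonFst '' J z, fun z => mortonSnd '' J z, fun a b ha hb => ?_,
    fun e he => ?_⟩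
  · have hN : D.total ≠ 0 := by omega
    -- The square of side 2 ^ log N contains all labels below N/2, and its area is at most N².
    have h1 := Nat.pow_log_le_self 2 hN
    have h2 := Nat.lt_pow_succ_log_self (b := 2) one_lt_two D.total
    rw [pow_succ] at h2
    obtain ⟨t, ht, rfl, rfl⟩ := exists_morton_eq (Nat.log 2 D.total) a b (by omega) (by omega)
    have h3 : 4 ^ Nat.log 2 D.total ≤ D.total ^ 2 := by
      rw [show 4 = 2 ^ 2 by norm_num, ← pow_mul, mul_comm, pow_mul]
      exact Nat.pow_le_pow_left h1 2
    obtain ⟨z, hz⟩ := exists_mem_interval key g hkey (t := t) (by omega)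
    exact ⟨z, ⟨t, hz, rfl⟩, t, hz, rfl⟩
  · have hle := hg e he
    -- Capacity 0 is separate: the rounding to a power of 2 below would still give nonempty
    -- projections.
    rcases Nat.eq_zero_or_pos (c e) with h0 | hpos
    · refine ⟨∅, ∅, by simp, by simp, fun z hz => ?_⟩
      have : g z = 0 := by
        refine Nat.eq_zero_of_le_zero ((Finset.single_le_sum (f := g)
          (fun _ _ => Nat.zero_le _) ?_).trans (hle.trans (by simp [h0])))
        exact Finset.mem_filter.mpr ⟨Finset.mem_univ _, hz⟩
      simp [J, this]
    obtain ⟨s, hs⟩ := exists_interval_of_convex key g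
      (Finset.univ.filter fun z : G.Node => z.1 ∈ G.tailSide e) (by
        intro a ha d hd b hab hbd
        simp only [Finset.mem_filter, Finset.mem_univ, true_and,
          G.mem_tailSide_iff_mem_trail he, mem_trail_iff_prefix] at ha hd ⊢
        exact prefix_of_le_of_le ha hd hab hbd)
    -- Chosen so that 3c < 2 ^ j ≤ 6c; two blocks of length 2 ^ j then give the 12.
    let j := Nat.log 2 (3 * c e) + 1
    have h1 : 2 ^ j ≤ 6 * c e := by
      have := Nat.pow_log_le_self 2 (x := 3 * c e) (by omega)
      rw [pow_succ]
      omega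
    have h2 : (3 * c e) ^ 2 ≤ 4 ^ j := by
      rw [show 4 = 2 ^ 2 by norm_num, ← pow_mul, mul_comm 2, pow_mul]
      exact Nat.pow_le_pow_left (Nat.lt_pow_succ_log_self one_lt_two _).le 2
    obtain ⟨P, hP, hPs⟩ := exists_card_le_of_div mortonFst_div j s
    obtain ⟨Q, hQ, hQs⟩ := exists_card_le_of_div mortonSnd_div j s
    refine ⟨P, Q, by omega, by omega, fun z hz => ?_⟩
    obtain ⟨hs1, hs2⟩ := hs z (Finset.mem_filter.mpr ⟨Finset.mem_univ _, hz⟩)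
    constructor
    · rintro _ ⟨t, ⟨ht1, ht2⟩, rfl⟩
      exact hPs t (by omega) (by omega)
    · rintro _ ⟨t, ⟨ht1, ht2⟩, rfl⟩
      exact hQs t (by omega) (by omega)

theorem card_le_of_label_mem {ι : Type*} {S : ι → Finset α} {lab : ι → α → ℕ}
    (hlab : ∀ i, ∀ a ∈ S i, ∀ j, ∀ b ∈ S j, lab i a = lab j b → a = b) {s : Finset α}
    {P : Finset ℕ} (hs : ∀ a ∈ s, ∃ i, a ∈ S i ∧ lab i a ∈ P) : s.card ≤ P.card := by
  rcases s.eq_empty_or_nonempty with rfl | ⟨a₀, ha₀⟩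
  · simp
  have : Nonempty ι := ⟨(hs a₀ ha₀).choose⟩
  choose! f hf using hs
  exact Finset.card_le_card_of_injOn (fun a => lab (f a) a) (fun a ha => (hf a ha).2)
    fun a ha b hb h => hlab _ a (hf a ha).1 _ b (hf b hb).1 h

/-- Feasible link capacities are met, up to a constant factor, by a one-round algorithm. -/
theorem Stats.Feasible.exists_algorithm [Finite V] {D : G.Stats} {r : V}
    {c : G.graph.Dart → ℕ} (h : D.Feasible r c) (hc : ∀ e, c e.symm = c e)
    (hRS : ∑ x, D.sizeR x = ∑ x, D.sizeS x) :
    ∃ A : G.Algorithm α, A.rounds = 1 ∧ ∀ I : G.Input α, I.HasStats D →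
      A.Computes I ∧ ∀ e, (A.traffic I 0 e).card ≤ 24 * c e := by
  classical
  obtain ⟨A, B, hcov, hproj⟩ := h.exists_rectangles
  obtain ⟨labR, hlabR⟩ := exists_labelling α D.sizeR
  obtain ⟨labS, hlabS⟩ := exists_labelling α D.sizeS
  refine ⟨⟨1, fun _ x X y => X.filter fun z => Sum.elim (fun a => labR x X.toLeft a ∈ A y)
    (fun b => labS x X.toRight b ∈ B y) z, fun _ _ _ _ => Finset.filter_subset _ _⟩, rfl,
    fun I hI => ?_⟩
  obtain ⟨hR1, hR2⟩ := hlabR I.R fun x => (hI x).1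
  obtain ⟨hS1, hS2⟩ := hlabS I.S fun x => (hI x).2
  have htot := D.total_eq
  refine ⟨fun x y a ha b hb => ?_, fun e => ?_⟩
  · obtain ⟨z, hza, hzb⟩ := hcov (labR x (I.R x) a) (labS y (I.S y) b)
      (by have := hR1 x a ha; omega) (by have := hS1 y b hb; omega)
    refine ⟨z, Finset.mem_union_right _ (Finset.mem_biUnion.mpr ⟨x, Finset.mem_univ _, ?_⟩),
      Finset.mem_union_right _ (Finset.mem_biUnion.mpr ⟨y, Finset.mem_univ _, ?_⟩)⟩
    · simpa [Algorithm.data, ha] using hza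
    · simpa [Algorithm.data, hb] using hzb
  -- Away from r, a link carries only labels in the projections for the nodes beyond it, 12c for
  -- each of R and S. Towards r, it carries at most the initial data below it, 3c.
  · rcases G.mem_tailSide_or e r with hr | hr
    · have hr' : r ∈ G.tailSide e.symm.symm := by simpa using hr
      obtain ⟨P, Q, hP, hQ, hPQ⟩ := hproj e.symm hr'
      rw [hc] at hP hQ
      rw [← Finset.card_toLeft_add_card_toRight]
      refine (Nat.add_le_add (card_le_of_label_mem hR2 (P := P) fun a ha => ?_)
        (card_le_of_label_mem hS2 (P := Q) fun b hb => ?_)).trans (by omega)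
      · rw [Finset.mem_toLeft] at ha
        obtain ⟨q, hq, hmem⟩ := Finset.mem_biUnion.mp ha
        have hq2 := (G.onRoute_iff.mp (Finset.mem_filter.mp hq).2).2
        simp only [Algorithm.data, Finset.mem_filter, Finset.inl_mem_disjSum, Sum.elim_inl,
          Finset.toLeft_disjSum] at hmem
        exact ⟨q.1, hmem.1, (hPQ q.2 hq2).1 hmem.2⟩
      · rw [Finset.mem_toRight] at hb
        obtain ⟨q, hq, hmem⟩ := Finset.mem_biUnion.mp hb
        have hq2 := (G.onRoute_iff.mp (Finset.mem_filter.mp hq).2).2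
        simp only [Algorithm.data, Finset.mem_filter, Finset.inr_mem_disjSum, Sum.elim_inr,
          Finset.toRight_disjSum] at hmem
        exact ⟨q.1, hmem.1, (hPQ q.2 hq2).2 hmem.2⟩
    · refine (Finset.card_le_card (Algorithm.traffic_zero_subset _ I e)).trans ?_
      have h1 := Input.card_initialOn_le hI (G.tailSide e)
      have h2 := h.sizeOn_tailSide_le hr
      omega

/-- There are feasible capacities that are the smallest ones for all roots and all costs. -/
theorem Stats.exists_feasible_forall_le [Finite V] (D : G.Stats) :
    ∃ r L, D.Feasible r (D.capacity L) ∧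
      ∀ r' L', D.Feasible r' (D.capacity L') → ∀ e, D.capacity L e ≤ D.capacity L' e := by
  classical
  have := Fintype.ofFinite V
  obtain ⟨r₀, hr₀⟩ := D.exists_isRoot
  -- The capacities of any two cost levels are comparable pointwise, so a least sum means least at
  -- every link. The level L = ⊤ shows that feasible ones exist.
  obtain ⟨⟨r, L⟩, hL, hmin⟩ := WellFounded.has_min
    (InvImage.wf (fun q : V × ℝ≥0∞ => ∑ e, D.capacity q.2 e) Nat.lt_wfRel.wf)
    {q | D.Feasible q.1 (D.capacity q.2)}
    ⟨(r₀, ⊤), hr₀.feasible le_top le_top fun _ => le_top⟩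
  refine ⟨r, L, hL, fun r' L' h' e => ?_⟩
  rcases le_total L L' with h | h
  · exact D.capacity_mono h e
  · have hle : ∀ e ∈ Finset.univ, D.capacity L' e ≤ D.capacity L e :=
      fun e _ => D.capacity_mono h e
    have hsum : ∑ e, D.capacity L e ≤ ∑ e, D.capacity L' e := not_lt.mp (hmin (r', L') h')
    exact ((Finset.sum_eq_sum_iff_of_le hle).mp
      ((Finset.sum_le_sum hle).antisymm hsum) e (Finset.mem_univ e)).ge

theorem Algorithm.cost_le_of_card_traffic_le {A : G.Algorithm α} {I : G.Input α} {D : G.Stats}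
    (hA : A.rounds = 1) {K : ℕ} {L : ℝ≥0∞}
    (h : ∀ e, (A.traffic I 0 e).card ≤ K * D.capacity L e) : A.cost I ≤ K * L := by
  rw [Algorithm.cost, hA, Finset.sum_range_one]
  refine iSup_le fun e => ?_
  calc _ ≤ ((K * D.capacity L e : ℕ) : ℝ≥0∞) / G.bandwidth e :=
        ENNReal.div_le_div_right (Nat.cast_le.mpr (h e)) _
    _ = K * ((D.capacity L e : ℝ≥0∞) / G.bandwidth e) := by rw [Nat.cast_mul, mul_div_assoc]
    _ ≤ K * L := by
        gcongr
        exact D.capacity_div_le L e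

end UpperBound

end SymmetricTree

end TopoMPC

/-! ### The main theorem -/

theorem mainTheorem3 :
    ∃ C : ℝ≥0, ∀ (V : Type u) [Finite V] (α : Type v) (G : TopoMPC.SymmetricTree V) (D : G.Stats),
      ∑ x, D.sizeR x = ∑ x, D.sizeS x →
      ∃ A : G.Algorithm α, A.rounds = 1 ∧
        ∀ I : G.Input α, I.HasStats D →
          A.Computes I ∧
          (∀ B : G.Algorithm α, B.Computes I → A.cost I ≤ C * B.cost I) ∧
          (∀ r : V, D.IsRoot r →
            A.cost I ≤ C * max (max D.edgeBound (D.coverBound r))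
              (⨆ e : G.graph.Dart, 1 / G.bandwidth e) ∧
            ∀ B : G.Algorithm α, B.Computes I →
              max D.edgeBound (D.coverBound r) ≤ C * B.cost I) := by
  refine ⟨24, fun V _ α G D hRS => ?_⟩
  obtain ⟨r₀, L, hL, hmin⟩ := D.exists_feasible_forall_le
  obtain ⟨A, hA, hAI⟩ := hL.exists_algorithm (α := α) (D.capacity_symm L) hRS
  refine ⟨A, hA, fun I hI => ?_⟩
  obtain ⟨hcomp, htraffic⟩ := hAI I hI
  -- Both upper bounds on the cost are instances: L' is the cost of B, or the maximum of the
  -- explicit bounds.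
  have hcost : ∀ r' L', D.Feasible r' (D.capacity L') → A.cost I ≤ (24 : ℝ≥0) * L' :=
    fun r' L' h => A.cost_le_of_card_traffic_le (K := 24) hA fun e =>
      (htraffic e).trans (Nat.mul_le_mul_left _ (hmin r' L' h e))
  refine ⟨hcomp, fun B hB => ?_, fun r hr => ⟨?_, fun B hB => ?_⟩⟩
  · exact hcost r₀ _ (hB.feasible hI hRS hL.isRoot)
  · refine hcost r _ (hr.feasible ?_ ?_ fun e => ?_)
    · exact (le_max_left _ _).trans (le_max_left _ _)
    · exact (le_max_right _ _).trans (le_max_left _ _)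
    · exact (le_iSup (fun e => 1 / G.bandwidth e) e).trans (le_max_right _ _)
  · have h := hB.feasible hI hRS hr
    refine (max_le h.edgeBound_le h.coverBound_le).trans (mul_le_mul_left ?_ _)
    exact_mod_cast (by norm_num : (3 : ℝ≥0) ≤ 24)
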